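/- Work with locally small categories, and call a category finitely complete if it has all finite limits, and a functor between finitely complete categories lex if it preserves finite limits. A class of lex-weights $\Phi$ assigns to each small finitely complete category $\mathcal K$ a collection $\Phi[\mathcal K]$ of presheaves $\phi\colon\mathcal K^{\mathrm{op}}\to\mathbf{Set}$. For a finitely complete category $\mathcal C$, let $\Phi(\mathcal C)$ be the closure of the representables in $[\mathcal C^{\mathrm{op}},\mathbf{Set}]$ under finite limits and under $\Phi$-lex-colimits, that is, weighted colimits $\phi\star D$ with $\phi\in\Phi[\mathcal K]$ and $D$ a lex functor on $\mathcal K$. Call $\mathcal C$ $\Phi$-exact if (i) for every small finitely complete $\mathcal K$, every $\phi\in\Phi(\mathcal K)$ and every lex $D\colon\mathcal K\to\mathcal C$, the colimit $\phi\star D$ exists in $\mathcal C$; and (ii) the restricted Yoneda embedding $\mathcal C\to\Phi(\mathcal C)$ has a left adjoint that preserves finite limits. Let $\Phi_{\mathrm{filt}}$ be the class of lex-weights consisting of the presheaves $\phi_{\mathcal J}\colon\mathcal F(\mathcal J)^{\mathrm{op}}\to\mathbf{Set}$, for $\mathcal J$ a small filtered category, where $E\colon\mathcal J\to\mathcal F(\mathcal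 J)$ is a free completion of $\mathcal J$ under finite limits and $\phi_{\mathcal J}$ is the left Kan extension along $E^{\mathrm{op}}$ of the terminal presheaf on $\mathcal J$. \textbf{Proposition.} A finitely complete category $\mathcal C$ is $\Phi_{\mathrm{filt}}$-exact if and only if it has small filtered colimits and these commute with finite limits. -/

import Mathlib

open CategoryTheory CategoryTheory.Limits Opposite

universe w v u v' u'

namespace LexColimits

section WeightedColimits

variable {K : Type u'} [Category.{v'} K] {C : Type u} [Category.{v} C]

/-- A cocone under `D : K ⥤ C` weighted by `φ : Kᵒᵖ ⥤ Type w`: an object `pt` of `C` together with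
a natural family of functions `φ k → C(D k, pt)`. -/
structure WeightedCocone (φ : Kᵒᵖ ⥤ Type w) (D : K ⥤ C) where
  pt : C
  leg : ∀ k : K, φ.obj (op k) → (D.obj k ⟶ pt)
  naturality : ∀ {k k' : K} (f : k ⟶ k') (x : φ.obj (op k')),
    leg k (φ.map f.op x) = D.map f ≫ leg k' x

/-- The weighted cocone `c` exhibits `c.pt` as the weighted colimit `φ ⋆ D`: composition with `c`
is a bijection from `C(c.pt, X)` to natural transformations `φ ⟶ C(D -, X)`, for every `X`. -/
def WeightedCocone.IsColimit {φ : Kᵒᵖ ⥤ Type w} {D : K ⥤ C} (c : WeightedCocone φ D) : Prop :=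
  ∀ t : WeightedCocone φ D, ∃! g : c.pt ⟶ t.pt, ∀ (k : K) (x : φ.obj (op k)),
    c.leg k x ≫ g = t.leg k x

end WeightedColimits

/-- A class `Φ` of lex-weights: for each small finitely complete category `K`, a collection `Φ[K]`
of presheaves on `K`. The presheaves themselves need not preserve any limits. -/
abbrev LexWeightClass : Type (v + 1) :=
  ∀ (K : Type v) [SmallCategory K] [HasFiniteLimits K], ObjectProperty (Kᵒᵖ ⥤ Type v)

/-- The closure of the representables in `[Cᵒᵖ, Set]` under finite limits and under `Φ`-lex-colimits,
i.e. colimits `φ ⋆ D` with `φ ∈ Φ[K]` and `D` a left exact functor on `K`. -/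
inductive lexClosure (Φ : LexWeightClass.{v}) (C : Type u) [Category.{v} C] :
    ObjectProperty (Cᵒᵖ ⥤ Type v)
  | representable (X : C) : lexClosure Φ C (yoneda.obj X)
  | finiteLimit {J : Type} [SmallCategory J] [FinCategory J] (F : J ⥤ Cᵒᵖ ⥤ Type v)
      (hF : ∀ j, lexClosure Φ C (F.obj j)) (c : Cone F) (hc : Nonempty (IsLimit c)) :
      lexClosure Φ C c.pt
  | lexColimit {K : Type v} [SmallCategory K] [HasFiniteLimits K] (φ : Kᵒᵖ ⥤ Type v) (hφ : Φ K φ)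
      (D : K ⥤ Cᵒᵖ ⥤ Type v) (hlex : PreservesFiniteLimits D)
      (hD : ∀ k, lexClosure Φ C (D.obj k)) (c : WeightedCocone φ D) (hc : c.IsColimit) :
      lexClosure Φ C c.pt

/-- The category `Φ(C)`, a full subcategory of `[Cᵒᵖ, Set]`. -/
abbrev Completion (Φ : LexWeightClass.{v}) (C : Type u) [Category.{v} C] :=
  (lexClosure Φ C).FullSubcategory

/-- The restricted Yoneda embedding `W : C ⥤ Φ(C)`. -/
def restrictedYoneda (Φ : LexWeightClass.{v}) (C : Type u) [Category.{v} C] :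
    C ⥤ Completion Φ C :=
  (lexClosure Φ C).lift yoneda lexClosure.representable

/-- The saturation `Φ*` of a class of lex-weights: `Φ*[K]` consists of the objects of `Φ(K)`. -/
def saturation (Φ : LexWeightClass.{v}) : LexWeightClass.{v} :=
  fun K _ _ => lexClosure Φ K

/-- `C` is `Φ`-lex-cocomplete: it is finitely complete, and `φ ⋆ D` exists for each `φ ∈ Φ[K]` and
each left exact `D : K ⥤ C`. -/
structure IsLexCocomplete (Φ : LexWeightClass.{v}) (C : Type u) [Category.{v} C] : Prop where
  hasFiniteLimits : HasFiniteLimits C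
  exists_colimit : ∀ (K : Type v) [SmallCategory K] [HasFiniteLimits K] (φ : Kᵒᵖ ⥤ Type v),
    Φ K φ → ∀ (D : K ⥤ C), PreservesFiniteLimits D → ∃ c : WeightedCocone φ D, c.IsColimit

/-- `C` is `Φ`-exact: it is `Φ*`-lex-cocomplete, and `W : C ⥤ Φ(C)` has a left exact left
adjoint. -/
structure IsExact (Φ : LexWeightClass.{v}) (C : Type u) [Category.{v} C] : Prop where
  isLexCocomplete : IsLexCocomplete (saturation Φ) C
  exists_leftAdjoint : ∃ L : Completion Φ C ⥤ C,
    Nonempty (L ⊣ restrictedYoneda Φ C) ∧ PreservesFiniteLimits L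

/-- `E : J ⥤ F` exhibits the finitely complete category `F` as a free completion of `J` under finite
limits: for each (possibly large) locally small finitely complete `D`, restriction along `E` is an
equivalence from the category of left exact functors `F ⥤ D` to the category of functors
`J ⥤ D`. -/
def IsFreeFiniteLimitCompletion {J F : Type v} [SmallCategory J] [SmallCategory F]
    (E : J ⥤ F) : Prop :=
  HasFiniteLimits F ∧ ∀ (D : Type (v + 1)) [Category.{v} D] [HasFiniteLimits D],
    (LeftExactFunctor.forget F D ⋙ (Functor.whiskeringLeft J F D).obj E).IsEquivalence

/-- The class `Φ_filt` of weights for filtered colimits: the presheaves `φ` on a free completion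
`E : J ⥤ K` of a small filtered category `J` under finite limits such that `φ` is the left Kan
extension along `Eᵒᵖ` of the terminal presheaf on `J`. -/
def filteredWeights : LexWeightClass.{v} :=
  fun K _ _ φ => ∃ (J : Type v) (_ : SmallCategory J) (_ : IsFiltered J) (E : J ⥤ K)
    (α : (⊤_ (Jᵒᵖ ⥤ Type v)) ⟶ E.op ⋙ φ),
    IsFreeFiniteLimitCompletion E ∧ φ.IsLeftKanExtension α

/-- `C` has small filtered colimits, and these commute with finite limits: for each small filtered
`J`, the functor `colim : [J, C] ⥤ C` preserves finite limits. -/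
def HasFilteredColimitsCommutingWithFiniteLimits (C : Type u) [Category.{v} C] : Prop :=
  ∃ _ : HasFilteredColimitsOfSize.{v, v} C,
    ∀ (J : Type v) [SmallCategory J] [IsFiltered J],
      PreservesFiniteLimits (colim : (J ⥤ C) ⥤ C)

end LexColimits

/-! The weight attached to a small filtered `J` is the colimit of the representables on the objects
`E j`, so the colimit of `D` with this weight is the ordinary colimit of `E ⋙ D`. Conversely every
diagram `J ⥤ C` extends along `E` to a left exact functor. Lex-colimits for these weights are thus
filtered colimits, and `Φ_filt(C)` is the category of ind-objects of `C`: it contains filtered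
colimits of representables, and ind-objects are closed under finite limits and filtered colimits.

If `W` has a left exact left adjoint `L`, then `L` sends the formal colimit of `G ⋙ yoneda` to a
colimit of `G` in `C`. Formal filtered colimits are left exact in `G`, because filtered colimits of
presheaves are computed in sets; applying `L` keeps this exactness. Conversely, filtered colimits in
`C` extend the left adjoint from representables to all ind-objects. The empty diagram, a pair or a
parallel pair of ind-objects each lifts to a finite diagram in `J ⥤ C` for a single filtered `J`,
and there `L` becomes `colim`, which is left exact by assumption
(`preservesFiniteLimits_leftAdjoint`).

Using these weights requires a small free completion of `J`. It is built as the closure of the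
representables under finite limits in `(J ⥤ Type v)ᵒᵖ`, and left exact functors out of it are
pointwise right Kan extensions along `E`. -/

namespace LexColimits

/-! ### Weighted colimits whose weight is a colimit of representables. -/

section WeightedColimits

universe v₂ u₂

variable {J : Type v} [SmallCategory J] {K : Type v} [SmallCategory K]
  {C : Type u₂} [Category.{v₂} C] {G : J ⥤ K}

/-- The element of the vertex of a cocone under `G ⋙ yoneda` corresponding to a leg. -/
def yonedaLeg (p : Cocone (G ⋙ yoneda)) (j : J) : p.pt.obj (op (G.obj j)) :=
  yonedaEquiv (F := p.pt) (p.ι.app j)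

lemma map_yonedaLeg (p : Cocone (G ⋙ yoneda)) {j j' : J} (f : j ⟶ j') :
    p.pt.map (G.map f).op (yonedaLeg p j') = yonedaLeg p j := by
  have h : yoneda.map (G.map f) ≫ p.ι.app j' = p.ι.app j := p.w f
  rw [yonedaLeg, yonedaLeg, ← h]
  exact yonedaEquiv_naturality (F := p.pt) (p.ι.app j') (G.map f)

lemma map_op_yonedaLeg (p : Cocone (G ⋙ yoneda)) (j : J) {k : K} (a : k ⟶ G.obj j) :
    p.pt.map a.op (yonedaLeg p j) = (p.ι.app j).app (op k) a :=
  map_yonedaEquiv (F := p.pt) (p.ι.app j) a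

lemma exists_map_yonedaLeg {p : Cocone (G ⋙ yoneda)} (hp : IsColimit p) {k : K}
    (x : p.pt.obj (op k)) :
    ∃ (j : J) (a : k ⟶ G.obj j), p.pt.map a.op (yonedaLeg p j) = x := by
  obtain ⟨j, a, ha⟩ :=
    Types.jointly_surjective _ (isColimitOfPreserves ((evaluation _ _).obj (op k)) hp) x
  exact ⟨j, a, (map_op_yonedaLeg p j a).trans ha⟩

/-- The cocone under `G ⋙ D` underlying a cocone under `D` weighted by the vertex of a cocone
under `G ⋙ yoneda`. -/
def WeightedCocone.toCocone {p : Cocone (G ⋙ yoneda)} {D : K ⥤ C} (c : WeightedCocone p.pt D) :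
    Cocone (G ⋙ D) where
  pt := c.pt
  ι :=
    { app := fun j => c.leg (G.obj j) (yonedaLeg p j)
      naturality := fun j j' f => by
        have h := c.naturality (G.map f) (yonedaLeg p j')
        rw [map_yonedaLeg] at h
        exact h.symm.trans (Category.comp_id _).symm }

lemma WeightedCocone.leg_map {p : Cocone (G ⋙ yoneda)} {D : K ⥤ C} (c : WeightedCocone p.pt D)
    (j : J) {k : K} (a : k ⟶ G.obj j) :
    c.leg k (p.pt.map a.op (yonedaLeg p j)) = D.map a ≫ c.leg (G.obj j) (yonedaLeg p j) :=
  c.naturality _ _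

/-- A cocone under `G ⋙ D` extends to a cocone under `D` weighted by a colimit of `G ⋙ yoneda`. -/
lemma exists_weightedCocone {p : Cocone (G ⋙ yoneda)} (hp : IsColimit p) {D : K ⥤ C}
    (s : Cocone (G ⋙ D)) :
    ∃ c : WeightedCocone p.pt D, c.toCocone = s := by
  have H : ∀ k : K, ∃ l : p.pt.obj (op k) → (D.obj k ⟶ s.pt), ∀ (j : J) (a : k ⟶ G.obj j),
      l (p.pt.map a.op (yonedaLeg p j)) = D.map a ≫ s.ι.app j := by
    intro k
    -- The hom-sets of `C` live in `Type v₂`, so the pointwise colimit is lifted before mapping out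
    -- of it. The case needed later is `C` a presheaf category.
    let q := isColimitOfPreserves uliftFunctor.{v₂, v}
      (isColimitOfPreserves ((evaluation _ _).obj (op k)) hp)
    let t : Cocone (((G ⋙ yoneda) ⋙ (evaluation _ _).obj (op k)) ⋙ uliftFunctor.{v₂, v}) :=
      { pt := ULift.{v} (D.obj k ⟶ s.pt)
        ι :=
          { app := fun j => TypeCat.ofHom fun a =>
              ⟨D.map (show k ⟶ G.obj j from a.down) ≫ s.ι.app j⟩
            naturality := fun j j' f => by
              ext ⟨a⟩
              have h : D.map (G.map f) ≫ s.ι.app j' = s.ι.app j := s.w f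
              refine congrArg ULift.up ?_
              change D.map (show k ⟶ G.obj j' from a ≫ G.map f) ≫ s.ι.app j' =
                D.map (show k ⟶ G.obj j from a) ≫ s.ι.app j
              rw [← h, ← Category.assoc, ← D.map_comp] } }
    refine ⟨fun x => (q.desc t ⟨x⟩).down, fun j a => ?_⟩
    rw [map_op_yonedaLeg]
    exact congrArg ULift.down (ConcreteCategory.congr_hom (q.fac t j) ⟨a⟩)
  choose l hl using H
  refine ⟨⟨s.pt, l, ?_⟩, ?_⟩
  · intro k k' f x
    obtain ⟨j, a, rfl⟩ := exists_map_yonedaLeg hp x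
    have h := hl k j (f ≫ a)
    rw [op_comp, p.pt.map_comp_apply] at h
    rw [h, hl, D.map_comp, Category.assoc]
  · obtain ⟨pt, ι⟩ := s
    simp only [WeightedCocone.toCocone]
    congr 1
    ext j
    have h := hl (G.obj j) j (𝟙 _)
    rw [op_id, p.pt.map_id_apply, D.map_id] at h
    exact h.trans (Category.id_comp _)

lemma WeightedCocone.comp_eq_iff {p : Cocone (G ⋙ yoneda)} (hp : Limits.IsColimit p) {D : K ⥤ C}
    (c t : WeightedCocone p.pt D) (g : c.pt ⟶ t.pt) :
    (∀ (k : K) (x : p.pt.obj (op k)), c.leg k x ≫ g = t.leg k x) ↔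
      ∀ j, c.leg (G.obj j) (yonedaLeg p j) ≫ g = t.leg (G.obj j) (yonedaLeg p j) := by
  refine ⟨fun h j => h _ _, fun h k x => ?_⟩
  obtain ⟨j, a, rfl⟩ := exists_map_yonedaLeg hp x
  rw [leg_map, leg_map, Category.assoc, h]

/-- If `φ` is a colimit of `G ⋙ yoneda`, then colimits of `D` weighted by `φ` are colimits of
`G ⋙ D`. -/
lemma WeightedCocone.isColimit_iff {p : Cocone (G ⋙ yoneda)} (hp : Limits.IsColimit p)
    {D : K ⥤ C} (c : WeightedCocone p.pt D) :
    c.IsColimit ↔ Nonempty (Limits.IsColimit c.toCocone) := by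
  constructor
  · intro h
    have H : ∀ s : Cocone (G ⋙ D), ∃! g : c.pt ⟶ s.pt,
        ∀ j, c.toCocone.ι.app j ≫ g = s.ι.app j := by
      intro s
      obtain ⟨t, rfl⟩ := exists_weightedCocone hp s
      obtain ⟨g, hg, hu⟩ := h t
      exact ⟨g, (comp_eq_iff hp c t g).1 hg, fun g' hg' => hu g' ((comp_eq_iff hp c t g').2 hg')⟩
    choose d hd hu using H
    exact ⟨⟨d, fun s => hd s, fun s m hm => hu s m hm⟩⟩
  · rintro ⟨h⟩ t
    exact ⟨h.desc t.toCocone, (comp_eq_iff hp c t _).2 (h.fac t.toCocone),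
      fun g hg => h.uniq t.toCocone g ((comp_eq_iff hp c t g).1 hg)⟩

end WeightedColimits

/-! ### The filtered weights as colimits of representables. -/

section KanExtension

variable {J : Type v} [SmallCategory J] {K : Type v} [SmallCategory K] {E : J ⥤ K}

/-- A left Kan extension of the terminal presheaf along `E.op` is a colimit of `E ⋙ yoneda`. -/
lemma exists_isColimit_of_isLeftKanExtension (φ : Kᵒᵖ ⥤ Type v)
    (α : (⊤_ (Jᵒᵖ ⥤ Type v)) ⟶ E.op ⋙ φ) [φ.IsLeftKanExtension α] :
    ∃ p : Cocone (E ⋙ yoneda), p.pt = φ ∧ Nonempty (IsColimit p) := by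
  let one : Jᵒᵖ ⥤ Type v := (Functor.const _).obj PUnit
  have hone : IsTerminal one := Functor.isTerminalConst _ Types.isTerminalPUnit
  let i : one ≅ ⊤_ (Jᵒᵖ ⥤ Type v) := hone.uniqueUpToIso terminalIsTerminal
  let e : ∀ j : J, φ.obj (op (E.obj j)) := fun j => (i.hom ≫ α).app (op j) PUnit.unit
  have he : ∀ {j j' : J} (f : j ⟶ j'), φ.map (E.map f).op (e j') = e j := fun {j j'} f =>
    (NatTrans.naturality_apply (i.hom ≫ α) f.op PUnit.unit).symm
  have key : ∀ (X : Kᵒᵖ ⥤ Type v) (x : ∀ j : J, X.obj (op (E.obj j))),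
      (∀ {j j' : J} (f : j ⟶ j'), X.map (E.map f).op (x j') = x j) →
      ∃! g : φ ⟶ X, ∀ j, g.app (op (E.obj j)) (e j) = x j := by
    intro X x hx
    let β : one ⟶ E.op ⋙ X :=
      { app := fun j => TypeCat.ofHom fun _ => x j.unop
        naturality := fun j j' f => by
          ext _
          exact (hx f.unop).symm }
    have aux : ∀ g : φ ⟶ X, (∀ j, g.app (op (E.obj j)) (e j) = x j) ↔
        α ≫ Functor.whiskerLeft E.op g = i.inv ≫ β := by
      intro g
      rw [← cancel_epi i.hom, Iso.hom_inv_id_assoc]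
      constructor
      · intro h
        ext j ⟨⟩
        exact h j.unop
      · intro h j
        exact ConcreteCategory.congr_hom (NatTrans.congr_app h (op j)) PUnit.unit
    refine ⟨φ.descOfIsLeftKanExtension α X (i.inv ≫ β),
      (aux _).2 (φ.descOfIsLeftKanExtension_fac α X _), fun g hg => ?_⟩
    refine φ.hom_ext_of_isLeftKanExtension α _ _ ?_
    rw [φ.descOfIsLeftKanExtension_fac]
    exact (aux g).1 hg
  refine ⟨⟨φ, { app := fun j => yonedaEquiv.symm (e j), naturality := fun j j' f => ?_ }⟩,
    rfl, ⟨?_⟩⟩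
  · refine Eq.trans ?_ (Category.comp_id _).symm
    change yoneda.map (E.map f) ≫ yonedaEquiv.symm (e j') = _
    rw [yonedaEquiv_symm_naturality_left, he]
  · have H : ∀ s : Cocone (E ⋙ yoneda), ∃! g : φ ⟶ s.pt,
        ∀ j, yonedaEquiv.symm (e j) ≫ g = s.ι.app j := by
      intro s
      obtain ⟨g, hg, hu⟩ := key s.pt (yonedaLeg s) (map_yonedaLeg s)
      have aux : ∀ g : φ ⟶ s.pt, (∀ j, yonedaEquiv.symm (e j) ≫ g = s.ι.app j) ↔
          ∀ j, g.app (op (E.obj j)) (e j) = yonedaLeg s j := by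
        intro g
        refine forall_congr' fun j => ?_
        rw [yonedaEquiv_symm_naturality_right, Equiv.symm_apply_eq]
        rfl
      exact ⟨g, (aux g).2 hg, fun g' hg' => hu g' ((aux g').1 hg')⟩
    choose d hd hu using H
    exact ⟨d, fun s => hd s, fun s m hm => hu s m hm⟩

end KanExtension

/-! ### Universal arrows and their compatibility with limits. -/

section RelativeAdjoint

universe v₁ v₂ v₃ u₁ u₂ u₃

variable {F : Type u₁} [Category.{v₁} F] {D : Type u₂} [Category.{v₂} D] {A : Type u₃}
  [Category.{v₃} A] {H : F ⥤ D} {N : D ⥤ A} {M : F ⥤ A}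

/-- The property of an object `X` that `ε.app X : N (H X) ⟶ M X` is a universal arrow
from `N` to `M X`. -/
def isUniversalAt (ε : H ⋙ N ⟶ M) : ObjectProperty F := fun X =>
  ∀ d : D, Function.Bijective fun f : d ⟶ H.obj X => N.map f ≫ ε.app X

/-- The morphism to `H X` induced by the universal arrow at `X`. -/
noncomputable def isUniversalAt.lift {ε : H ⋙ N ⟶ M} {X : F} (h : isUniversalAt ε X) {d : D}
    (τ : N.obj d ⟶ M.obj X) : d ⟶ H.obj X :=
  ((h d).2 τ).choose

lemma isUniversalAt.fac {ε : H ⋙ N ⟶ M} {X : F} (h : isUniversalAt ε X) {d : D}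
    (τ : N.obj d ⟶ M.obj X) : N.map (h.lift τ) ≫ ε.app X = τ :=
  ((h d).2 τ).choose_spec

lemma isUniversalAt.hom_ext {ε : H ⋙ N ⟶ M} {X : F} (h : isUniversalAt ε X) {d : D}
    {f g : d ⟶ H.obj X} (hfg : N.map f ≫ ε.app X = N.map g ≫ ε.app X) : f = g :=
  (h d).1 hfg

lemma map_comp_app (ε : H ⋙ N ⟶ M) {d : D} {X Y : F} (f : d ⟶ H.obj X) (g : X ⟶ Y) :
    N.map (f ≫ H.map g) ≫ ε.app Y = (N.map f ≫ ε.app X) ≫ M.map g := by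
  have h : N.map (H.map g) ≫ ε.app Y = ε.app X ≫ M.map g := ε.naturality g
  rw [N.map_comp, Category.assoc, Category.assoc, h]

/-- Maps into `H c.pt` and into `M c.pt` are compatible families of maps into the terms of the two
diagrams, and these families correspond term by term. -/
lemma isUniversalAt_of_isLimit (ε : H ⋙ N ⟶ M) {K : Type w} [Category.{w} K] {P : K ⥤ F}
    {c : Cone P} (hH : IsLimit (H.mapCone c)) (hM : IsLimit (M.mapCone c))
    (h : ∀ k, isUniversalAt ε (P.obj k)) : isUniversalAt ε c.pt := by
  refine fun d => ⟨fun f g hfg => hH.hom_ext fun k => (h k).hom_ext ?_, fun τ => ?_⟩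
  · change N.map (f ≫ H.map (c.π.app k)) ≫ _ = N.map (g ≫ H.map (c.π.app k)) ≫ _
    rw [map_comp_app, map_comp_app]
    exact congrArg (· ≫ M.map (c.π.app k)) hfg
  · let s : Cone (P ⋙ H) :=
      { pt := d
        π :=
          { app := fun k => (h k).lift (τ ≫ M.map (c.π.app k))
            naturality := fun k k' f => by
              refine (Category.id_comp _).trans ((h k').hom_ext ?_)
              refine ((h k').fac _).trans ?_
              change _ = N.map (_ ≫ H.map (P.map f)) ≫ _
              rw [map_comp_app, (h k).fac, Category.assoc, ← M.map_comp, c.w] } }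
    refine ⟨hH.lift s, hM.hom_ext fun k => ?_⟩
    change (N.map (hH.lift s) ≫ ε.app c.pt) ≫ M.map (c.π.app k) = τ ≫ M.map (c.π.app k)
    rw [← map_comp_app]
    have : hH.lift s ≫ H.map (c.π.app k) = (h k).lift (τ ≫ M.map (c.π.app k)) := hH.fac s k
    rw [this, (h k).fac]

instance (ε : H ⋙ N ⟶ M) : (isUniversalAt ε).IsClosedUnderIsomorphisms where
  of_iso {X Y} e h d := by
    have hk : ∀ f : d ⟶ H.obj Y, N.map f ≫ ε.app Y =
        (N.map (f ≫ H.map e.inv) ≫ ε.app X) ≫ M.map e.hom := fun f => by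
      rw [← map_comp_app, Category.assoc, ← H.map_comp, e.inv_hom_id, H.map_id, Category.comp_id]
    refine ⟨fun f g hfg => ?_, fun τ => ⟨h.lift (τ ≫ M.map e.inv) ≫ H.map e.hom, ?_⟩⟩
    · have hfg' : N.map f ≫ ε.app Y = N.map g ≫ ε.app Y := hfg
      rw [← cancel_mono (H.map e.inv)]
      refine h.hom_ext ?_
      rw [map_comp_app, map_comp_app, hfg']
    · change N.map (_ ≫ _) ≫ _ = τ
      rw [map_comp_app, h.fac, Category.assoc, ← M.map_comp, e.inv_hom_id, M.map_id,
        Category.comp_id]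

lemma isClosedUnderLimitsOfShape_isUniversalAt (ε : H ⋙ N ⟶ M) (K : Type w) [Category.{w} K]
    [PreservesLimitsOfShape K H] [PreservesLimitsOfShape K M] :
    (isUniversalAt ε).IsClosedUnderLimitsOfShape K where
  limitsOfShape_le := by
    rintro X ⟨p⟩
    exact isUniversalAt_of_isLimit ε (isLimitOfPreserves H p.isLimit)
      (isLimitOfPreserves M p.isLimit) p.prop_diag_obj

/-- A functor given by universal arrows from `N` to `M` preserves all limits that `M` preserves. -/
lemma preservesLimitsOfShape_of_isUniversalAt (ε : H ⋙ N ⟶ M) (h : ∀ X, isUniversalAt ε X)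
    (K : Type w) [Category.{w} K] [PreservesLimitsOfShape K M] :
    PreservesLimitsOfShape K H where
  preservesLimit {P} := ⟨fun {c} hc => by
    have hM := isLimitOfPreserves M hc
    let t : ∀ s : Cone (P ⋙ H), Cone (P ⋙ M) := fun s =>
      { pt := N.obj s.pt
        π :=
          { app := fun k => N.map (s.π.app k) ≫ ε.app (P.obj k)
            naturality := fun k k' f => by
              refine (Category.id_comp _).trans ?_
              refine Eq.trans ?_ (map_comp_app ε (s.π.app k) (P.map f))
              rw [← s.w f]
              rfl } }
    exact ⟨{
      lift := fun s => (h c.pt).lift (hM.lift (t s))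
      fac := fun s k => (h (P.obj k)).hom_ext (by
        change N.map (_ ≫ H.map (c.π.app k)) ≫ _ = _
        rw [map_comp_app, (h c.pt).fac]
        exact hM.fac (t s) k)
      uniq := fun s m hm => (h c.pt).hom_ext (by
        rw [(h c.pt).fac]
        refine hM.uniq (t s) _ fun k => ?_
        change (N.map m ≫ ε.app c.pt) ≫ M.map (c.π.app k) = N.map (s.π.app k) ≫ ε.app (P.obj k)
        rw [← map_comp_app, ← hm k]
        rfl) }⟩⟩

/-- Functors given by universal arrows from `N` to `M` are isomorphic. -/
noncomputable def isoOfIsUniversalAt {H' : F ⥤ D} (ε : H ⋙ N ⟶ M) (h : ∀ X, isUniversalAt ε X)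
    (ε' : H' ⋙ N ⟶ M) (h' : ∀ X, isUniversalAt ε' X) : H ≅ H' :=
  NatIso.ofComponents
    (fun X =>
      { hom := (h' X).lift (ε.app X)
        inv := (h X).lift (ε'.app X)
        hom_inv_id := (h X).hom_ext (by
          rw [N.map_comp, Category.assoc, (h X).fac, (h' X).fac, N.map_id]
          exact (Category.id_comp _).symm)
        inv_hom_id := (h' X).hom_ext (by
          rw [N.map_comp, Category.assoc, (h' X).fac, (h X).fac, N.map_id]
          exact (Category.id_comp _).symm) })
    (fun {X Y} f => (h' Y).hom_ext (by
      rw [map_comp_app, (h' X).fac, N.map_comp, Category.assoc, (h' Y).fac]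
      exact ε.naturality f))

end RelativeAdjoint

/-! ### Nerves, and universal arrows as pointwise right Kan extensions. -/

section Nerve

universe u₁ u₂

variable {J : Type v} [SmallCategory J] {F : Type u₁} [Category.{v} F]
  {D : Type u₂} [Category.{v} D]

/-- The functor sending `d` to the functor `D(d, G -)`. -/
def nerve (G : J ⥤ D) : D ⥤ (J ⥤ Type v)ᵒᵖ :=
  (coyoneda ⋙ (Functor.whiskeringLeft J D (Type v)).obj G).rightOp

/-- The morphism `nerve G d ⟶ nerve E X` given by a natural family of maps. -/
def nerveHomMk {G : J ⥤ D} {E : J ⥤ F} {d : D} {X : F}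
    (x : ∀ j : J, (X ⟶ E.obj j) → (d ⟶ G.obj j))
    (hx : ∀ {j j' : J} (f : j ⟶ j') (u : X ⟶ E.obj j), x j' (u ≫ E.map f) = x j u ≫ G.map f) :
    (nerve G).obj d ⟶ (nerve E).obj X :=
  Quiver.Hom.op (X := (nerve E).obj X |>.unop) (Y := (nerve G).obj d |>.unop)
    { app := fun j => TypeCat.ofHom (x j)
      naturality := fun j j' f => by
        ext u
        exact hx f u }

/-- The components of a morphism `nerve G d ⟶ nerve E X`. -/
def nerveHomApp {G : J ⥤ D} {E : J ⥤ F} {d : D} {X : F}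
    (τ : (nerve G).obj d ⟶ (nerve E).obj X) (j : J) (u : X ⟶ E.obj j) : d ⟶ G.obj j :=
  τ.unop.app j u

lemma nerveHomApp_naturality {G : J ⥤ D} {E : J ⥤ F} {d : D} {X : F}
    (τ : (nerve G).obj d ⟶ (nerve E).obj X) {j j' : J} (f : j ⟶ j') (u : X ⟶ E.obj j) :
    nerveHomApp τ j' (u ≫ E.map f) = nerveHomApp τ j u ≫ G.map f :=
  NatTrans.naturality_apply τ.unop f u

lemma nerveHom_ext {G : J ⥤ D} {E : J ⥤ F} {d : D} {X : F}
    {τ τ' : (nerve G).obj d ⟶ (nerve E).obj X}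
    (h : ∀ j u, nerveHomApp τ j u = nerveHomApp τ' j u) : τ = τ' := by
  apply Quiver.Hom.unop_inj
  ext j u
  exact h j u

/-- The action of a functor `H` on morphisms, as a morphism of nerves. -/
def nerveComparison (E : J ⥤ F) (H : F ⥤ D) : H ⋙ nerve (E ⋙ H) ⟶ nerve E where
  app _ := nerveHomMk (G := E ⋙ H) (fun _ u => H.map u) (fun f u => H.map_comp u (E.map f))
  naturality _ _ f := nerveHom_ext (G := E ⋙ H) fun _ u => (H.map_comp f u).symm

/-- Yoneda: a natural family on maps `E j ⟶ E j'` is determined by its value at the identity of `E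
j`. -/
lemma isUniversalAt_nerveComparison_obj (E : J ⥤ F) [E.Full] (H : F ⥤ D) (j : J) :
    isUniversalAt (nerveComparison E H) (E.obj j) := by
  refine fun d => ⟨fun f g hfg => ?_, fun τ => ⟨nerveHomApp τ j (𝟙 _), ?_⟩⟩
  · have h := congrArg (fun τ => nerveHomApp (G := E ⋙ H) τ j (𝟙 _)) hfg
    change f ≫ H.map (𝟙 _) = g ≫ H.map (𝟙 _) at h
    rwa [H.map_id, Category.comp_id, Category.comp_id] at h
  · refine nerveHom_ext (G := E ⋙ H) fun j' u => ?_
    obtain ⟨a, rfl⟩ := E.map_surjective u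
    have h := nerveHomApp_naturality τ a (𝟙 _)
    rw [Category.id_comp] at h
    exact h.symm

/-- For `E` fully faithful, the canonical morphism `nerve G (G j) ⟶ nerve E (E j)`. -/
noncomputable def nerveUnit (E : J ⥤ F) [E.Full] [E.Faithful] (G : J ⥤ D) : G ⋙ nerve G ⟶ E ⋙ nerve E where
  app j := nerveHomMk (fun _ u => G.map (E.preimage u)) (fun f u => by
    rw [← G.map_comp]
    congr 1
    apply E.map_injective
    simp)
  naturality j j' f := nerveHom_ext fun i u => by
    change G.map f ≫ G.map (E.preimage u) = G.map (E.preimage (E.map f ≫ u))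
    rw [← G.map_comp]
    congr 1
    apply E.map_injective
    simp

lemma isUniversalAt_nerveUnit (E : J ⥤ F) [E.Full] [E.Faithful] (G : J ⥤ D) (j : J) :
    isUniversalAt (nerveUnit E G) j := by
  refine fun d => ⟨fun f g hfg => ?_, fun τ => ⟨nerveHomApp τ j (𝟙 _), ?_⟩⟩
  · have h := congrArg (fun τ => nerveHomApp (E := E) τ j (𝟙 _)) hfg
    change f ≫ G.map (E.preimage (𝟙 _)) = g ≫ G.map (E.preimage (𝟙 _)) at h
    rwa [E.preimage_id, G.map_id, Category.comp_id, Category.comp_id] at h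
  · refine nerveHom_ext (E := E) fun j' u => ?_
    obtain ⟨a, rfl⟩ := E.map_surjective u
    have h := nerveHomApp_naturality τ a (𝟙 _)
    rw [Category.id_comp] at h
    rw [h]
    change nerveHomApp τ j (𝟙 _) ≫ G.map (E.preimage (E.map a)) = _
    rw [E.preimage_map]

end Nerve

/-! ### A criterion for free completions under finite limits. -/

section FreeCompletion

universe u₁ u₂

/-- A functor `E` that is fully faithful, generates its codomain under finite limits, and is such
that the presheaves `F(-, E j)` turn finite limits into colimits. -/
structure IsFinitelyGenerating {J F : Type v} [SmallCategory J] [SmallCategory F]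
    (E : J ⥤ F) : Prop where
  full : E.Full
  faithful : E.Faithful
  preservesFiniteLimits : PreservesFiniteLimits (nerve E)
  induction (Q : ObjectProperty F) [Q.IsClosedUnderIsomorphisms]
    (hQ : ∀ (K : Type) [SmallCategory K] [FinCategory K], Q.IsClosedUnderLimitsOfShape K)
    (hE : ∀ j, Q (E.obj j)) (X : F) : Q X

variable {J F : Type v} [SmallCategory J] [SmallCategory F] {E : J ⥤ F}
  {D : Type u₂} [Category.{v} D]

namespace IsFinitelyGenerating

/-- A left exact `H` is the pointwise right Kan extension of its restriction along `E`: this holds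
on the image of `E` by Yoneda and is stable under finite limits, which generate `F`. -/
lemma isUniversalAt_nerveComparison (hE : IsFinitelyGenerating E) (H : F ⥤ D)
    [PreservesFiniteLimits H] (X : F) : isUniversalAt (nerveComparison E H) X := by
  have := hE.full
  have := hE.preservesFiniteLimits
  exact hE.induction _ (fun K => isClosedUnderLimitsOfShape_isUniversalAt _ K)
    (isUniversalAt_nerveComparison_obj E H) X

lemma hom_ext (hE : IsFinitelyGenerating E) (H : F ⥤ D)
    [PreservesFiniteLimits H] {X : F} {d : D} {f g : d ⟶ H.obj X}
    (h : ∀ (j : J) (u : X ⟶ E.obj j), f ≫ H.map u = g ≫ H.map u) : f = g :=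
  (hE.isUniversalAt_nerveComparison H X).hom_ext (nerveHom_ext (G := E ⋙ H) h)

lemma exists_lift (hE : IsFinitelyGenerating E) (H : F ⥤ D)
    [PreservesFiniteLimits H] {X : F} {d : D}
    (x : ∀ j : J, (X ⟶ E.obj j) → (d ⟶ H.obj (E.obj j)))
    (hx : ∀ {j j' : J} (f : j ⟶ j') (u : X ⟶ E.obj j),
      x j' (u ≫ E.map f) = x j u ≫ H.map (E.map f)) :
    ∃ f : d ⟶ H.obj X, ∀ (j : J) (u : X ⟶ E.obj j), f ≫ H.map u = x j u := by
  let τ := nerveHomMk (G := E ⋙ H) x hx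
  refine ⟨(hE.isUniversalAt_nerveComparison H X).lift τ, fun j u => ?_⟩
  exact congrArg (fun τ => nerveHomApp (G := E ⋙ H) τ j u)
    ((hE.isUniversalAt_nerveComparison H X).fac τ)

lemma natTrans_ext (hE : IsFinitelyGenerating E) {H H' : F ⥤ D}
    [PreservesFiniteLimits H'] {α β : H ⟶ H'} (h : ∀ j, α.app (E.obj j) = β.app (E.obj j)) :
    α = β := by
  ext X
  refine hE.hom_ext H' fun j u => ?_
  rw [← α.naturality, ← β.naturality, h]

lemma exists_natTrans (hE : IsFinitelyGenerating E) {H H' : F ⥤ D}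
    [PreservesFiniteLimits H'] (γ : E ⋙ H ⟶ E ⋙ H') :
    ∃ α : H ⟶ H', ∀ j, α.app (E.obj j) = γ.app j := by
  have hγ : ∀ {j j' : J} (f : j ⟶ j'),
      H.map (E.map f) ≫ γ.app j' = γ.app j ≫ H'.map (E.map f) := fun f => γ.naturality f
  have key : ∀ X, ∃ f : H.obj X ⟶ H'.obj X, ∀ (j : J) (u : X ⟶ E.obj j),
      f ≫ H'.map u = H.map u ≫ γ.app j := fun X =>
    hE.exists_lift H' (fun j u => H.map u ≫ γ.app j) fun f u => by
      rw [H.map_comp, Category.assoc, Category.assoc, hγ]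
  choose a ha using key
  refine ⟨{ app := a, naturality := fun X Y f => hE.hom_ext H' fun j u => ?_ }, fun j => ?_⟩
  · rw [Category.assoc, Category.assoc, ha, ← H'.map_comp, ha, H.map_comp, Category.assoc]
  · have h := ha (E.obj j) j (𝟙 _)
    rwa [H.map_id, H'.map_id, Category.comp_id, Category.id_comp] at h

/-- Pointwise existence of the right Kan extension of `G` along `E`: at `E j` it is `G j`, and the
objects where it exists are closed under finite limits since `D` has them. -/
lemma rightAdjointObjIsDefined_nerve (hE : IsFinitelyGenerating E) [HasFiniteLimits D]
    (G : J ⥤ D) (X : F) : (nerve G).rightAdjointObjIsDefined ((nerve E).obj X) := by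
  have := hE.full
  have := hE.faithful
  have := hE.preservesFiniteLimits
  have hc : (nerve G).rightAdjointObjIsDefined.IsClosedUnderIsomorphisms :=
    ⟨fun {X Y} e (h : ((nerve G).op ⋙ yoneda.obj X).IsRepresentable) =>
      have := h
      isRepresentable_of_natIso ((nerve G).op ⋙ yoneda.obj X)
        (Functor.isoWhiskerLeft _ (yoneda.mapIso e))⟩
  refine hE.induction ((nerve G).rightAdjointObjIsDefined.inverseImage (nerve E)) ?_ ?_ X
  · intro K _ _
    have : (nerve G).rightAdjointObjIsDefined.IsClosedUnderLimitsOfShape K :=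
      ⟨by rintro X ⟨p⟩; exact Functor.rightAdjointObjIsDefined_of_isLimit p.isLimit p.prop_diag_obj⟩
    infer_instance
  · intro j
    have e : ((nerve G).op ⋙ yoneda.obj ((nerve E).obj (E.obj j))).RepresentableBy (G.obj j) :=
      { homEquiv := fun {d} => Equiv.ofBijective _ (isUniversalAt_nerveUnit E G j d)
        homEquiv_comp := fun f g => by
          change (nerve G).map (f ≫ g) ≫ _ = (nerve G).map f ≫ (nerve G).map g ≫ _
          rw [Functor.map_comp, Category.assoc] }
    exact e.isRepresentable

/-- Every functor to a finitely complete category extends along `E` to a left exact functor. -/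
lemma exists_extension (hE : IsFinitelyGenerating E) [HasFiniteLimits D] (G : J ⥤ D) :
    ∃ H : F ⥤ D, PreservesFiniteLimits H ∧ Nonempty (E ⋙ H ≅ G) := by
  have := hE.full
  have := hE.faithful
  have := hE.preservesFiniteLimits
  let N := nerve G
  let S : F ⥤ N.PartialRightAdjointSource :=
    ObjectProperty.lift _ (nerve E) (hE.rightAdjointObjIsDefined_nerve G)
  let H : F ⥤ D := S ⋙ N.partialRightAdjoint
  let ε : H ⋙ N ⟶ nerve E :=
    { app := fun X => N.partialRightAdjointHomEquiv (Y := S.obj X) (𝟙 _)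
      naturality := fun X Y f => by
        have h := N.partialRightAdjointHomEquiv_map (S.map f)
        have h' := N.partialRightAdjointHomEquiv_comp (𝟙 _) (N.partialRightAdjointMap (S.map f))
        rw [Category.comp_id, h] at h'
        exact h'.symm }
  have hε : ∀ X, isUniversalAt ε X := fun X d => by
    convert! (N.partialRightAdjointHomEquiv (X := d) (Y := S.obj X)).bijective using 1
    ext f
    have h' := N.partialRightAdjointHomEquiv_comp (Y := S.obj X) (𝟙 _) f
    exact h'.symm.trans (congrArg N.partialRightAdjointHomEquiv (Category.comp_id f))
  refine ⟨H, ⟨fun K _ _ => preservesLimitsOfShape_of_isUniversalAt ε hε K⟩, ⟨?_⟩⟩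
  -- Both `E ⋙ H` and `G` are given by universal arrows from `N` to `E ⋙ nerve E`.
  exact isoOfIsUniversalAt (H := E ⋙ H) (N := N) (M := E ⋙ nerve E) (Functor.whiskerLeft E ε)
    (fun j => hε (E.obj j)) (nerveUnit E G) (isUniversalAt_nerveUnit E G)

lemma isFreeFiniteLimitCompletion (hE : IsFinitelyGenerating E) [HasFiniteLimits F] :
    IsFreeFiniteLimitCompletion E := by
  refine ⟨inferInstance, fun D _ _ => ?_⟩
  refine { faithful := ⟨?_⟩, full := ⟨?_⟩, essSurj := ⟨?_⟩ }
  · intro H H' α β h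
    have : PreservesFiniteLimits H'.obj := H'.property
    apply ObjectProperty.hom_ext
    exact hE.natTrans_ext fun j => NatTrans.congr_app h j
  · intro H H' γ
    have : PreservesFiniteLimits H'.obj := H'.property
    obtain ⟨α, hα⟩ := hE.exists_natTrans (H := H.obj) (H' := H'.obj) γ
    refine ⟨⟨α⟩, ?_⟩
    ext j
    exact hα j
  · intro G
    obtain ⟨H, hH, ⟨e⟩⟩ := hE.exists_extension G
    exact ⟨⟨H, hH⟩, ⟨e⟩⟩

end IsFinitelyGenerating

end FreeCompletion

/-! ### Existence of a small free completion under finite limits. -/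

section Construction

universe v₁ u₁

/-- An induction principle for the closure of a property of objects under a family of limits. -/
lemma limitsClosure_fullSubcategory_induction {A : Type u₁} [Category.{v₁} A]
    (P : ObjectProperty A) {ι : Type w} (S : ι → Type w) [∀ i, SmallCategory (S i)]
    (Q : ObjectProperty (P.limitsClosure S).FullSubcategory) [Q.IsClosedUnderIsomorphisms]
    (hQ : ∀ i, Q.IsClosedUnderLimitsOfShape (S i))
    (hP : ∀ (Y : A) (hY : P Y), Q ⟨Y, P.le_limitsClosure S _ hY⟩)
    (X : (P.limitsClosure S).FullSubcategory) : Q X := by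
  -- `Q` makes sense only on the closure, so membership is carried along in the induction.
  let R : ObjectProperty A := fun Y => ∃ h : P.limitsClosure S Y, Q ⟨Y, h⟩
  have hi : R.IsClosedUnderIsomorphisms :=
    ⟨fun {Y Z} e ⟨h, hY⟩ => ⟨(P.limitsClosure S).prop_of_iso e h,
      Q.prop_of_iso ((P.limitsClosure S).isoMk e) hY⟩⟩
  have hl : ∀ i, R.IsClosedUnderLimitsOfShape (S i) := fun i => ⟨by
    rintro Y ⟨p⟩
    have hY : P.limitsClosure S Y :=
      (P.limitsClosure S).prop_of_isLimit p.isLimit fun j => (p.prop_diag_obj j).1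
    refine ⟨hY, ?_⟩
    let K : S i ⥤ (P.limitsClosure S).FullSubcategory :=
      (P.limitsClosure S).lift p.diag fun j => (p.prop_diag_obj j).1
    let c : Cone K :=
      { pt := ⟨Y, hY⟩
        π :=
          { app := fun j => ⟨p.π.app j⟩
            naturality := fun j j' f => by
              apply ObjectProperty.hom_ext
              exact p.π.naturality f } }
    have hc : IsLimit c := isLimitOfReflects (P.limitsClosure S).ι p.isLimit
    exact Q.prop_of_isLimit hc fun j => (p.prop_diag_obj j).2⟩
  have : P.limitsClosure S ≤ R :=
    ObjectProperty.limitsClosure_le fun Y hY => ⟨P.le_limitsClosure S _ hY, hP Y hY⟩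
  exact (this _ X.property).2

variable {J F : Type v} [SmallCategory J] [SmallCategory F]

/-- A fully faithful functor to `(J ⥤ Type v)ᵒᵖ` extending the Yoneda embedding is a nerve. -/
noncomputable def nerveIso (E : J ⥤ F) (ι : F ⥤ (J ⥤ Type v)ᵒᵖ) [ι.Full] [ι.Faithful]
    (i : E ⋙ ι ≅ coyoneda.rightOp) : ι ≅ nerve E :=
  NatIso.ofComponents
    (fun X => Iso.op (X := (nerve E).obj X |>.unop) (Y := (ι.obj X).unop)
      (NatIso.ofComponents
        (fun j => Equiv.toIso <|
          (Functor.FullyFaithful.ofFullyFaithful ι).homEquiv.trans <|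
          ((i.app j).homToEquiv (Z := ι.obj X)).trans <|
          (opEquiv (ι.obj X) (op (coyoneda.obj (op j)))).trans <|
          coyonedaEquiv (F := (ι.obj X).unop))
        (fun {j j'} f => by
          ext u
          have hi : ι.map (E.map f) ≫ i.hom.app j' = i.hom.app j ≫ (coyoneda.map f.op).op :=
            i.hom.naturality f
          obtain ⟨u, rfl⟩ : ∃ v : X ⟶ E.obj j, v = u := ⟨u, rfl⟩
          change (ι.map (u ≫ E.map f) ≫ i.hom.app j').unop.app j' (𝟙 j') =
            (ι.obj X).unop.map f ((ι.map u ≫ i.hom.app j).unop.app j (𝟙 j))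
          rw [ι.map_comp, Category.assoc, hi, ← Category.assoc, ← NatTrans.naturality_apply]
          change (ι.map u ≫ i.hom.app j).unop.app j' (f ≫ 𝟙 j') =
            (ι.map u ≫ i.hom.app j).unop.app j' (𝟙 j ≫ f)
          rw [Category.comp_id, Category.id_comp])))
    (fun {X Y} f => by
      apply Quiver.Hom.unop_inj
      ext j u
      obtain ⟨u, rfl⟩ : ∃ v : Y ⟶ E.obj j, v = u := ⟨u, rfl⟩
      change (ι.map f).unop.app j ((ι.map u ≫ i.hom.app j).unop.app j (𝟙 j)) =
        (ι.map (f ≫ u) ≫ i.hom.app j).unop.app j (𝟙 j)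
      rw [ι.map_comp, Category.assoc]
      rfl)

/-- A small category has a small free completion under finite limits. -/
lemma exists_isFinitelyGenerating (J : Type v) [SmallCategory J] :
    ∃ (F : Type v) (_ : SmallCategory F) (_ : HasFiniteLimits F) (E : J ⥤ F),
      IsFinitelyGenerating E := by
  let y : J ⥤ (J ⥤ Type v)ᵒᵖ := coyoneda.rightOp
  -- A small family representing all finite categories up to equivalence; smallness makes the
  -- closure essentially small.
  let S := SmallCategoryCardinalLT.categoryFamily Cardinal.aleph0.{0}
  let P₀ : ObjectProperty (J ⥤ Type v)ᵒᵖ := .ofObj y.obj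
  let P := P₀.limitsClosure S
  have : ObjectProperty.EssentiallySmall.{v} P := inferInstance
  have : EssentiallySmall.{v} P.FullSubcategory := inferInstance
  have hfin : ∀ i, Nonempty (FinCategory (S i)) := fun i =>
    (Arrow.finite_iff _).1 ((hasCardinalLT_aleph0_iff _).1
      (SmallCategoryCardinalLT.hasCardinalLT _ i))
  have hS : ∀ (K : Type) [SmallCategory K] [FinCategory K], ∃ i, Nonempty (S i ≌ K) := by
    intro K _ _
    exact SmallCategoryCardinalLT.exists_equivalence _ K
      ((hasCardinalLT_aleph0_iff _).2 inferInstance)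
  have hP : ∀ (K : Type) [SmallCategory K] [FinCategory K], P.IsClosedUnderLimitsOfShape K := by
    intro K _ _
    obtain ⟨i, ⟨e⟩⟩ := hS K
    exact .of_equivalence e
  have : HasFiniteLimits P.FullSubcategory := ⟨fun K _ _ => by
    have := hP K
    infer_instance⟩
  have : PreservesFiniteLimits P.ι := ⟨fun K _ _ => by
    have := hP K
    infer_instance⟩
  let e := equivSmallModel.{v} P.FullSubcategory
  let F := SmallModel.{v} P.FullSubcategory
  let E₀ : J ⥤ P.FullSubcategory := P.lift y fun j => P₀.le_limitsClosure S _ (.mk j)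
  let E : J ⥤ F := E₀ ⋙ e.functor
  let ι : F ⥤ (J ⥤ Type v)ᵒᵖ := e.inverse ⋙ P.ι
  have : y.Full := inferInstance
  have : y.Faithful := inferInstance
  have : E₀.Full := inferInstance
  have : E₀.Faithful := inferInstance
  have : HasFiniteLimits F :=
    ⟨fun K _ _ => Adjunction.hasLimitsOfShape_of_equivalence e.inverse⟩
  let i : E ⋙ ι ≅ y := Functor.isoWhiskerLeft E₀ (Functor.isoWhiskerRight e.unitIso.symm P.ι)
  refine ⟨F, inferInstance, this, E, inferInstance, inferInstance, ?_, ?_⟩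
  · have : PreservesFiniteLimits ι := comp_preservesFiniteLimits _ _
    exact preservesFiniteLimits_of_natIso (nerveIso E ι i)
  · intro Q _ hQ hE X
    have := limitsClosure_fullSubcategory_induction P₀ S (Q.inverseImage e.functor)
      (fun i => by
        obtain ⟨_⟩ := hfin i
        have := hQ (S i)
        infer_instance)
      (fun Y hY => by
        obtain ⟨j⟩ := hY
        exact hE j)
      (e.inverse.obj X)
    exact Q.prop_of_iso (e.counitIso.app X) this

end Construction
-- Basic properties of `Φ(C)`.
section Closure

variable {Φ : LexWeightClass.{v}} {C : Type u} [Category.{v} C]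

/-- Any object isomorphic to `X` is a limit of the one-object diagram at `X`. -/
lemma lexClosure_of_iso {X Y : Cᵒᵖ ⥤ Type v} (e : X ≅ Y) (hX : lexClosure Φ C X) :
    lexClosure Φ C Y := by
  let c : Cone (Functor.fromPUnit.{0} X) := { pt := Y, π := { app := fun _ => e.inv } }
  have hc : IsLimit c :=
    { lift := fun s => s.π.app ⟨⟨⟩⟩ ≫ e.hom
      fac := fun s j => by
        change (s.π.app ⟨⟨⟩⟩ ≫ e.hom) ≫ e.inv = _
        rw [Category.assoc, e.hom_inv_id]
        exact Category.comp_id _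
      uniq := fun s m hm => by
        rw [← hm ⟨⟨⟩⟩, Category.assoc]
        exact ((congrArg (m ≫ ·) e.inv_hom_id).trans (Category.comp_id m)).symm }
  exact lexClosure.finiteLimit _ (fun _ => hX) c ⟨hc⟩

instance : (lexClosure Φ C).IsClosedUnderIsomorphisms := ⟨lexClosure_of_iso⟩

instance (J : Type) [SmallCategory J] [FinCategory J] :
    (lexClosure Φ C).IsClosedUnderLimitsOfShape J :=
  ⟨by rintro X ⟨p⟩; exact lexClosure.finiteLimit _ p.prop_diag_obj _ ⟨p.isLimit⟩⟩

instance : HasFiniteLimits (Completion Φ C) := ⟨fun _ _ _ => inferInstance⟩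

instance : (restrictedYoneda Φ C).Full :=
  inferInstanceAs ((lexClosure Φ C).lift yoneda lexClosure.representable).Full

instance : (restrictedYoneda Φ C).Faithful :=
  inferInstanceAs ((lexClosure Φ C).lift yoneda lexClosure.representable).Faithful

end Closure

/-! ### Formal colimits and cocones. -/

section ColimitsOfRepresentables

variable {C : Type u} [Category.{v} C]

/-- Morphisms from a colimit of representables to a representable are cocones. -/
noncomputable def formalColimitHomEquiv {J : Type v} [SmallCategory J]
    (G : J ⥤ C) (X : C) :
    (colimit (G ⋙ yoneda) ⟶ yoneda.obj X) ≃ (G ⟶ (Functor.const J).obj X) where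
  toFun f :=
    { app := fun j => yoneda.preimage (colimit.ι (G ⋙ yoneda) j ≫ f)
      naturality := fun j j' a => yoneda.map_injective <| by
        have h : yoneda.map (G.map a) ≫ colimit.ι (G ⋙ yoneda) j' = colimit.ι (G ⋙ yoneda) j :=
          colimit.w (G ⋙ yoneda) a
        refine Eq.trans ?_ (congrArg yoneda.map (Category.comp_id _).symm)
        rw [yoneda.map_comp, yoneda.map_preimage, yoneda.map_preimage, ← h, Category.assoc] }
  invFun τ := colimit.desc (G ⋙ yoneda)
    { pt := yoneda.obj X
      ι :=
        { app := fun j => yoneda.map (τ.app j)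
          naturality := fun j j' a => by
            refine Eq.trans ?_ (Category.comp_id _).symm
            refine (yoneda.map_comp (G.map a) (τ.app j')).symm.trans (congrArg yoneda.map ?_)
            exact (τ.naturality a).trans (Category.comp_id _) } }
  left_inv f := colimit.hom_ext fun j => (colimit.ι_desc _ j).trans (yoneda.map_preimage _)
  right_inv τ := by
    ext j
    apply yoneda.map_injective
    exact (yoneda.map_preimage _).trans (colimit.ι_desc _ j)

lemma yoneda_map_formalColimitHomEquiv_app {J : Type v} [SmallCategory J] (G : J ⥤ C) (X : C)
    (f : colimit (G ⋙ yoneda) ⟶ yoneda.obj X) (j : J) :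
    yoneda.map ((formalColimitHomEquiv G X f).app j) = colimit.ι (G ⋙ yoneda) j ≫ f :=
  yoneda.map_preimage _

lemma formalColimitHomEquiv_naturality_left {J : Type v} [SmallCategory J] {G G' : J ⥤ C} {X : C}
    (α : G ⟶ G') (f : colimit (G' ⋙ yoneda) ⟶ yoneda.obj X) :
    formalColimitHomEquiv G X (colim.map (Functor.whiskerRight α yoneda) ≫ f) =
      α ≫ formalColimitHomEquiv G' X f := by
  ext j
  apply yoneda.map_injective
  have h : colimit.ι (G ⋙ yoneda) j ≫ colim.map (Functor.whiskerRight α yoneda) =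
    yoneda.map (α.app j) ≫ colimit.ι (G' ⋙ yoneda) j := ι_colimMap _ _
  have h' : yoneda.map ((α ≫ formalColimitHomEquiv G' X f).app j) =
    yoneda.map (α.app j) ≫ yoneda.map ((formalColimitHomEquiv G' X f).app j) :=
      yoneda.map_comp _ _
  rw [h', yoneda_map_formalColimitHomEquiv_app, yoneda_map_formalColimitHomEquiv_app,
    ← Category.assoc, ← Category.assoc, h]

lemma formalColimitHomEquiv_naturality_right {J : Type v} [SmallCategory J] {G : J ⥤ C} {X X' : C}
    (f : colimit (G ⋙ yoneda) ⟶ yoneda.obj X) (g : X ⟶ X') :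
    formalColimitHomEquiv G X' (f ≫ yoneda.map g) =
      formalColimitHomEquiv G X f ≫ (Functor.const J).map g := by
  ext j
  apply yoneda.map_injective
  have h : yoneda.map ((formalColimitHomEquiv G X f ≫ (Functor.const J).map g).app j) =
    yoneda.map ((formalColimitHomEquiv G X f).app j) ≫ yoneda.map g := yoneda.map_comp _ _
  rw [h, yoneda_map_formalColimitHomEquiv_app, yoneda_map_formalColimitHomEquiv_app,
    Category.assoc]

end ColimitsOfRepresentables

/-! ### From exactness to filtered colimits. -/

section FilteredClosure

variable {C : Type u} [Category.{v} C] [HasFiniteLimits C]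

lemma lexClosure_colimit_comp_yoneda {J : Type v} [SmallCategory J] [IsFiltered J] (G : J ⥤ C) :
    lexClosure filteredWeights.{v} C (colimit (G ⋙ yoneda)) := by
  obtain ⟨F, _, _, E, hE⟩ := exists_isFinitelyGenerating J
  let φ := E.op.leftKanExtension (⊤_ (Jᵒᵖ ⥤ Type v))
  let α := E.op.leftKanExtensionUnit (⊤_ (Jᵒᵖ ⥤ Type v))
  have hφ : filteredWeights.{v} F φ :=
    ⟨J, _, inferInstance, E, α, hE.isFreeFiniteLimitCompletion, inferInstance⟩
  obtain ⟨p, hpφ, ⟨hp⟩⟩ := exists_isColimit_of_isLeftKanExtension φ α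
  -- Extending `G` itself, rather than `G ⋙ yoneda`, keeps the values of the diagram representable;
  -- Yoneda then preserves left exactness.
  obtain ⟨H, hH, ⟨e⟩⟩ := hE.exists_extension G
  obtain ⟨c, hc⟩ := exists_weightedCocone hp (colimit.cocone (E ⋙ H ⋙ yoneda))
  have hc' : c.IsColimit := (c.isColimit_iff hp).2 ⟨hc ▸ colimit.isColimit _⟩
  have h := lexClosure.lexColimit (Φ := filteredWeights.{v}) p.pt (hpφ ▸ hφ) (H ⋙ yoneda)
    (comp_preservesFiniteLimits _ _) (fun k => lexClosure.representable _) c hc'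
  have hpt : c.pt = colimit (E ⋙ H ⋙ yoneda) := congrArg Cocone.pt hc
  rw [hpt] at h
  exact lexClosure_of_iso (HasColimit.isoOfNatIso (Functor.isoWhiskerRight e yoneda)) h

variable (C) in
/-- The functor sending a filtered diagram `G` in `C` to the colimit of `G ⋙ yoneda`. -/
noncomputable def filteredColim (J : Type v) [SmallCategory J] [IsFiltered J] :
    (J ⥤ C) ⥤ Completion filteredWeights.{v} C :=
  (lexClosure filteredWeights.{v} C).lift
    ((Functor.whiskeringRight J C (Cᵒᵖ ⥤ Type v)).obj yoneda ⋙ colim)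
    lexClosure_colimit_comp_yoneda

instance (J : Type v) [SmallCategory J] [IsFiltered J] (T : Type) [SmallCategory T]
    [FinCategory T] : PreservesLimitsOfShape T (filteredColim C J) := by
  have : PreservesLimitsOfShape T
    (filteredColim C J ⋙ (lexClosure filteredWeights.{v} C).ι) :=
    inferInstanceAs (PreservesLimitsOfShape T
      ((Functor.whiskeringRight J C (Cᵒᵖ ⥤ Type v)).obj yoneda ⋙ colim))
  exact preservesLimitsOfShape_of_reflects_of_preserves _ (lexClosure filteredWeights.{v} C).ι

/-- A left adjoint of the restricted Yoneda embedding induces left adjoints of diagonals. -/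
noncomputable def filteredColimCompAdjunction (J : Type v) [SmallCategory J] [IsFiltered J]
    {L : Completion filteredWeights.{v} C ⥤ C} (adj : L ⊣ restrictedYoneda _ C) :
    filteredColim C J ⋙ L ⊣ Functor.const J :=
  Adjunction.mkOfHomEquiv
    { homEquiv := fun G X =>
        ((adj.homEquiv ((filteredColim C J).obj G) X).trans
          (lexClosure filteredWeights.{v} C).fullyFaithfulι.homEquiv).trans
            (formalColimitHomEquiv G X)
      homEquiv_naturality_left_symm := fun {G G' X} f g => by
        rw [Equiv.symm_apply_eq]
        obtain ⟨h, rfl⟩ := (((adj.homEquiv ((filteredColim C J).obj G') X).trans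
          (lexClosure filteredWeights.{v} C).fullyFaithfulι.homEquiv).trans
            (formalColimitHomEquiv G' X)).surjective g
        rw [Equiv.symm_apply_apply]
        refine (formalColimitHomEquiv_naturality_left f (adj.homEquiv _ _ h).hom).symm.trans ?_
        refine congrArg (fun k : (filteredColim C J).obj G ⟶ (restrictedYoneda _ C).obj X =>
          formalColimitHomEquiv G X k.hom) ?_
        exact (adj.homEquiv_naturality_left ((filteredColim C J).map f) h).symm
      homEquiv_naturality_right := fun {G X X'} f g => by
        refine Eq.trans ?_ (formalColimitHomEquiv_naturality_right (adj.homEquiv _ _ f).hom g)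
        refine congrArg (fun k : (filteredColim C J).obj G ⟶ (restrictedYoneda _ C).obj X' =>
          formalColimitHomEquiv G X' k.hom) ?_
        exact adj.homEquiv_naturality_right f g }

/-- By uniqueness of adjoints, `colim` is `filteredColim C J ⋙ L`, a composite of left exact
functors. -/
lemma hasFilteredColimits_of_isExact (h : IsExact filteredWeights.{v} C) :
    HasFilteredColimitsCommutingWithFiniteLimits C := by
  obtain ⟨L, ⟨adj⟩, hL⟩ := h.exists_leftAdjoint
  have hJ : ∀ (J : Type v) [SmallCategory J] [IsFiltered J], HasColimitsOfShape J C :=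
    fun J _ _ => hasColimitsOfShape_iff_isRightAdjoint_const.2
      ⟨_, ⟨filteredColimCompAdjunction J adj⟩⟩
  refine ⟨⟨fun J _ _ => hJ J⟩, fun J _ _ => ?_⟩
  have := hJ J
  let e : filteredColim C J ⋙ L ≅ colim :=
    (filteredColimCompAdjunction J adj).leftAdjointUniq colimConstAdj
  exact ⟨fun T _ _ => preservesLimitsOfShape_of_natIso e⟩

end FilteredClosure

/-! ### From filtered colimits to exactness, through ind-objects. -/

section IndObjects

variable {C : Type u} [Category.{v} C] [HasFiniteLimits C]

/-- `Ind C` has finite limits because `C` does, and its inclusion into presheaves preserves them. -/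
lemma isIndObject_of_isLimit {T : Type} [SmallCategory T] [FinCategory T] {F : T ⥤ Cᵒᵖ ⥤ Type v}
    (hF : ∀ t, IsIndObject (F.obj t)) {c : Cone F} (hc : IsLimit c) : IsIndObject c.pt := by
  let K : T ⥤ Ind C := ObjectProperty.lift _ F hF ⋙ (Ind.equivalence C).inverse
  let e : K ⋙ Ind.inclusion C ≅ F :=
    Functor.isoWhiskerLeft (ObjectProperty.lift _ F hF)
      (Functor.isoWhiskerRight (Ind.equivalence C).counitIso (ObjectProperty.ι _))
  have hl := isLimitOfPreserves (Ind.inclusion C) (limit.isLimit K)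
  exact (Ind.isIndObject_inclusion_obj (limit K)).map (hl.conePointsIsoOfNatIso hc e).hom

lemma isIndObject_of_lexClosure {φ : Cᵒᵖ ⥤ Type v} (h : lexClosure filteredWeights.{v} C φ) :
    IsIndObject φ := by
  induction h with
  | representable X => exact isIndObject_yoneda X
  | finiteLimit F hF c hc ih => exact isIndObject_of_isLimit ih hc.some
  | lexColimit φ hφ D hlex hD c hc ih =>
    obtain ⟨J, _, _, E, α, -, _⟩ := hφ
    obtain ⟨p, rfl, ⟨hp⟩⟩ := exists_isColimit_of_isLeftKanExtension φ α
    obtain ⟨h⟩ := (c.isColimit_iff hp).1 hc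
    exact ObjectProperty.prop_of_iso (IsIndObject (C := _))
      ((colimit.isColimit (E ⋙ D)).coconePointUniqueUpToIso h)
      (isIndObject_colimit J (E ⋙ D) fun j => ih _)

lemma isLexCocomplete_saturation [HasFilteredColimitsOfSize.{v, v} C] :
    IsLexCocomplete (saturation filteredWeights.{v}) C := by
  refine ⟨inferInstance, fun K _ _ φ hφ D _ => ?_⟩
  obtain ⟨⟨P⟩⟩ := isIndObject_of_lexClosure hφ
  obtain ⟨c, hc⟩ := exists_weightedCocone P.coconeIsColimit (colimit.cocone (P.F ⋙ D))
  exact ⟨c, (c.isColimit_iff P.coconeIsColimit).2 ⟨hc ▸ colimit.isColimit _⟩⟩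

/-- The left adjoint is defined at representables by full faithfulness, and at filtered colimits of
them because `C` has the corresponding colimits. -/
lemma isRightAdjoint_restrictedYoneda [HasFilteredColimitsOfSize.{v, v} C] :
    (restrictedYoneda filteredWeights.{v} C).IsRightAdjoint := by
  apply Functor.isRightAdjoint_of_leftAdjointObjIsDefined_eq_top
  ext X
  simp only [Pi.top_apply, Prop.top_eq_true, iff_true]
  obtain ⟨⟨P⟩⟩ := isIndObject_of_lexClosure X.property
  let c : Cocone (P.F ⋙ restrictedYoneda filteredWeights.{v} C) :=
    { pt := X
      ι :=
        { app := fun i => ⟨P.ι.app i⟩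
          naturality := fun i j f => by
            apply ObjectProperty.hom_ext
            exact P.ι.naturality f } }
  have hc : IsColimit c :=
    isColimitOfReflects (lexClosure filteredWeights.{v} C).ι P.coconeIsColimit
  refine Functor.leftAdjointObjIsDefined_of_isColimit hc fun i => ?_
  have e : (restrictedYoneda filteredWeights.{v} C ⋙ coyoneda.obj
      (op ((restrictedYoneda filteredWeights.{v} C).obj (P.F.obj i)))).CorepresentableBy
        (P.F.obj i) :=
    { homEquiv := (Functor.FullyFaithful.ofFullyFaithful
        (restrictedYoneda filteredWeights.{v} C)).homEquiv
      homEquiv_comp := fun g f => (restrictedYoneda filteredWeights.{v} C).map_comp f g }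
  exact e.isCorepresentable

variable [HasFilteredColimitsOfSize.{v, v} C]
  (hC : ∀ (J : Type v) [SmallCategory J] [IsFiltered J],
    PreservesFiniteLimits (colim : (J ⥤ C) ⥤ C))
  {L : Completion filteredWeights.{v} C ⥤ C} (adj : L ⊣ restrictedYoneda _ C)

include hC adj

/-- The limit cone of `G` stays a limit cone under `filteredColim C J` and also after `L`, because
the composite is `colim`. -/
lemma preservesLimit_of_iso_comp_filteredColim {T : Type} [SmallCategory T] [FinCategory T]
    {K : T ⥤ Completion filteredWeights.{v} C} {J : Type v} [SmallCategory J] [IsFiltered J]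
    (G : T ⥤ J ⥤ C) (e : G ⋙ filteredColim C J ≅ K) : PreservesLimit K L := by
  have := hC J
  let i : filteredColim C J ⋙ L ≅ colim :=
    (filteredColimCompAdjunction J adj).leftAdjointUniq colimConstAdj
  have : PreservesLimitsOfShape T (filteredColim C J ⋙ L) :=
    preservesLimitsOfShape_of_natIso i.symm
  have : PreservesLimit (G ⋙ filteredColim C J) L :=
    preservesLimit_of_preserves_limit_cone
      (isLimitOfPreserves (filteredColim C J) (limit.isLimit G))
      (isLimitOfPreserves (filteredColim C J ⋙ L) (limit.isLimit G))
  exact preservesLimit_of_iso_diagram L e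

lemma preservesFiniteLimits_leftAdjoint : PreservesFiniteLimits L := by
  have h₀ : PreservesLimitsOfShape (Discrete PEmpty.{1}) L := ⟨fun {K} =>
    preservesLimit_of_iso_comp_filteredColim hC adj (J := Discrete PUnit.{v + 1})
      (Functor.empty _) (Functor.emptyExt _ _)⟩
  have h₁ : PreservesLimitsOfShape WalkingParallelPair L := ⟨fun {K} => by
    -- Two parallel maps of ind-objects are induced by two natural transformations between diagrams
    -- on one filtered category.
    obtain ⟨P⟩ := nonempty_indParallelPairPresentation
      (isIndObject_of_lexClosure (K.obj .zero).property)
      (isIndObject_of_lexClosure (K.obj .one).property)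
      (K.map WalkingParallelPairHom.left).hom (K.map WalkingParallelPairHom.right).hom
    refine preservesLimit_of_iso_comp_filteredColim hC adj (parallelPair P.φ P.ψ)
      (((Functor.whiskeringRight WalkingParallelPair _ _).obj
        (lexClosure filteredWeights.{v} C).ι).preimageIso ?_)
    exact P.parallelPairIsoParallelPairCompYoneda.symm ≪≫
      (diagramIsoParallelPair (K ⋙ (lexClosure filteredWeights.{v} C).ι)).symm⟩
  have h₂ : PreservesLimitsOfShape (Discrete WalkingPair) L := ⟨fun {K} => by
    obtain ⟨⟨P⟩⟩ := isIndObject_of_lexClosure (K.obj ⟨.left⟩).property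
    obtain ⟨⟨Q⟩⟩ := isIndObject_of_lexClosure (K.obj ⟨.right⟩).property
    -- The projections of a product of filtered categories are final, so both diagrams can be
    -- reindexed over `P.I × Q.I` without changing their colimits.
    let e₁ : colimit ((CategoryTheory.Prod.fst P.I Q.I ⋙ P.F) ⋙ yoneda) ≅ (K.obj ⟨.left⟩).obj :=
      Functor.Final.colimitIso (CategoryTheory.Prod.fst P.I Q.I) (P.F ⋙ yoneda) ≪≫
        (colimit.isColimit _).coconePointUniqueUpToIso P.coconeIsColimit
    let e₂ : colimit ((CategoryTheory.Prod.snd P.I Q.I ⋙ Q.F) ⋙ yoneda) ≅ (K.obj ⟨.right⟩).obj :=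
      Functor.Final.colimitIso (CategoryTheory.Prod.snd P.I Q.I) (Q.F ⋙ yoneda) ≪≫
        (colimit.isColimit _).coconePointUniqueUpToIso Q.coconeIsColimit
    exact preservesLimit_of_iso_comp_filteredColim hC adj (J := P.I × Q.I)
      (pair (CategoryTheory.Prod.fst P.I Q.I ⋙ P.F) (CategoryTheory.Prod.snd P.I Q.I ⋙ Q.F))
      (mapPairIso ((lexClosure filteredWeights.{v} C).isoMk e₁)
        ((lexClosure filteredWeights.{v} C).isoMk e₂))⟩
  have : PreservesFiniteProducts L := .of_preserves_binary_and_terminal L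
  exact preservesFiniteLimits_of_preservesEqualizers_and_finiteProducts L

end IndObjects

end LexColimits

/-- A finitely complete category is `Φ_filt`-exact if and only if it has filtered colimits and these
commute with finite limits. -/
theorem mainTheorem10 (C : Type u) [Category.{v} C] [HasFiniteLimits C] :
    LexColimits.IsExact LexColimits.filteredWeights.{v} C ↔
      LexColimits.HasFilteredColimitsCommutingWithFiniteLimits C := by
  refine ⟨LexColimits.hasFilteredColimits_of_isExact, fun ⟨_, hC⟩ => ?_⟩
  have := LexColimits.isRightAdjoint_restrictedYoneda (C := C)
  let adj := Adjunction.ofIsRightAdjoint (LexColimits.restrictedYoneda LexColimits.filteredWeights C)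
  exact ⟨LexColimits.isLexCocomplete_saturation,
    ⟨_, ⟨adj⟩, LexColimits.preservesFiniteLimits_leftAdjoint hC adj⟩⟩
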